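/- **Proposition 6.** Let $X$ be a Polish space with a non-zero, $\sigma$-finite, non-atomic Borel measure $m$ and let $T:X\to X$ be measurable with $m\circ T^{-1}=m$. Call a collection $R$ of Borel sets of finite measure a *dense, $T$-invariant, hereditary ring* if it contains $\emptyset$ and is closed under finite unions and differences; every Borel subset of a member of $R$ is in $R$; $A\in R$ implies $T^{-1}A\in R$; and for every Borel set $A$ with $m(A)<\infty$ and every $\epsilon>0$ there is $B\in R$ with $m(A\triangle B)<\epsilon$. Suppose that $(X,m,T)$ is weakly rationally ergodic, with the dense, $T$-invariant, hereditary ring $R(T)$ and the return sequence $a(n)>0$ $(n\ge1)$, i.e. $$\frac1{a(n)}\sum_{k=0}^{n-1}m(A\cap T^{-k}B)\xrightarrow[n\to\infty]{}m(A)m(B)\qquad\forall\ A,B\in R(T).$$ Write $S_n(f):=\sum_{k=0}^{n-1}f\circ T^k$ and $m(f):=\int_X f\,dm$, and suppose that for every $f\in L^1(m)$, $S_n(f)/a(n)\to m(f)$ in measure on every set of finite measure. Then, for all $f\in L^1(m)$ with $f\ge0$, all bounded continuous $g:[0,\infty)\to\mathbb R$ and all $A,B\in R(T)$, $$\frac1{a(n)}\sum_{k=1}^n\left|\int_A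 g\!\left(\tfrac{S_k(f)}{a(k)}\right)1_B\circ T^k\,dm-g(m(f))\,m(A\cap T^{-k}B)\right|\xrightarrow[n\to\infty]{}0.$$ If, in addition, $(X,m,T)$ is rationally weakly mixing with weights $u_n\in\mathbb R$ $(n\ge 1)$, i.e. for all $A,B$ in some dense, $T$-invariant, hereditary ring, $$\sum_{n=1}^N\left|m(A\cap T^{-n}B)-m(A)m(B)u_n\right|=o\Big(\sum_{n=1}^Nu_n\Big)\quad\text{as } N\to\infty,$$ then $a(N)\sim\sum_{n=1}^Nu_n$ and, for all $f\in L^1(m)$ with $f\ge0$, all bounded continuous $g:[0,\infty)\to\mathbb R$ and all $B,C\in R(T)$, $$\frac1{a(N)}\sum_{n=1}^N\left|\int_{B\cap T^{-n}C}g\!\left(\tfrac{S_n(f)}{a(n)}\right)dm-m(B)m(C)\,g(m(f))\,u_n\right|\xrightarrow[N\to\infty]{}0.$$ -/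

import Mathlib

open MeasureTheory Filter Topology Asymptotics
open scoped NNReal BoundedContinuousFunction symmDiff

/-- A `T`-invariant hereditary ring `R` of measurable sets of finite `m`-measure which is dense in
the sets of finite measure (with respect to the distance `m (A ∆ B)`). -/
structure IsDenseInvariantHereditaryRing {X : Type*} [MeasurableSpace X] (m : Measure X)
    (T : X → X) (R : Set (Set X)) : Prop where
  isSetRing : IsSetRing R
  measurableSet : ∀ A ∈ R, MeasurableSet A
  measure_lt_top : ∀ A ∈ R, m A < ⊤
  hereditary : ∀ A ∈ R, ∀ B, MeasurableSet B → B ⊆ A → B ∈ R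
  invariant : ∀ A ∈ R, T ⁻¹' A ∈ R
  dense : ∀ A, MeasurableSet A → m A < ⊤ → ∀ ε : ENNReal, 0 < ε → ∃ B ∈ R, m (A ∆ B) < ε

/-- `(X, m, T)` is weakly rationally ergodic with ring `R = R(T)` and return sequence
`a(n) = a_n(T)`. -/
structure IsWeaklyRationallyErgodic {X : Type*} [MeasurableSpace X] (m : Measure X)
    (T : X → X) (R : Set (Set X)) (a : ℕ → ℝ) : Prop where
  measurePreserving : MeasurePreserving T m m
  ring : IsDenseInvariantHereditaryRing m T R
  pos : ∀ n, 1 ≤ n → 0 < a n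
  tendsto : ∀ A ∈ R, ∀ B ∈ R,
    Tendsto (fun n : ℕ => (1 / a n) * ∑ k ∈ Finset.range n, m.real (A ∩ T^[k] ⁻¹' B))
      atTop (𝓝 (m.real A * m.real B))

/-- `(X, m, T)` is rationally weakly mixing with weights `u n`: for `A`, `B` in a dense,
`T`-invariant, hereditary ring,
`∑_{n ≤ N} |m(A ∩ T⁻ⁿ B) - m(A) m(B) u_n| = o(∑_{n ≤ N} u_n)`. -/
def IsRationallyWeaklyMixing {X : Type*} [MeasurableSpace X] (m : Measure X)
    (T : X → X) (u : ℕ → ℝ) : Prop :=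
  MeasurePreserving T m m ∧
  ∃ R : Set (Set X), IsDenseInvariantHereditaryRing m T R ∧
    ∀ A ∈ R, ∀ B ∈ R,
      (fun N : ℕ => ∑ n ∈ Finset.Icc 1 N,
          |m.real (A ∩ T^[n] ⁻¹' B) - m.real A * m.real B * u n|)
        =o[atTop] (fun N : ℕ => ∑ n ∈ Finset.Icc 1 N, u n)

/-- Convergence in measure on every set of finite measure (the usual meaning of convergence in
measure when `m` is an infinite, σ-finite measure). -/
def TendstoInMeasureOnFinite {X : Type*} [MeasurableSpace X] (m : Measure X)
    (F : ℕ → X → ℝ) (F₀ : X → ℝ) : Prop :=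
  ∀ A, MeasurableSet A → m A < ⊤ → TendstoInMeasure (m.restrict A) F atTop F₀

/-!
Since `S_n(1_B) / a(n)` is nonnegative, converges in measure on `A` and its mean over `A` converges
to the integral of the limit, no mass escapes: subsets of `A` of vanishing measure contribute only
`o(a(n))` to `∑_{k < n} m(A ∩ T⁻ᵏ B)`.

Monotonicity of `S_k(f)` lets two times control a whole window. If `a` varies by a factor close to
`1` on `[p, n]`, a deviation of `S_k(f) / a(k)` from `m(f)` at some time `k` of the window forces a
deviation at `p` or at `n`, which happens only on a small set. Hence the contribution `Φ(n)` of the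
deviating points satisfies `Φ(n) ≤ Φ(p) + o(a(n))`. As `a` is asymptotic to a monotone sequence with
bounded increments, the window can be chosen with `a(p) ≤ q a(n)` for a fixed `q < 1`, and iterating
gives `Φ = o(a)`.

For the weights `u`, a set of positive measure in both rings gives `a(N) ∼ ∑_{n ≤ N} u_n`, and
approximation by the ring of rational weak mixing replaces `m(B ∩ T⁻ⁿ C)` by `m(B) m(C) u_n` on
average.
-/

section Asymptotics

variable {ι E F G : Type*} {l : Filter ι} [SeminormedAddCommGroup E] [SeminormedAddCommGroup F]
  [SeminormedAddCommGroup G]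

theorem isLittleO_of_forall_norm_le_mul_add {ψ : ι → E} {v : ι → F} {a : ι → G}
    (hv : v =O[l] a)
    (h : ∀ w > 0, ∃ e : ι → ℝ, e =o[l] a ∧ ∀ᶠ n in l, ‖ψ n‖ ≤ w * ‖v n‖ + ‖e n‖) :
    ψ =o[l] a := by
  obtain ⟨C, hC, hvC⟩ := hv.exists_pos
  refine isLittleO_iff.2 fun ε hε => ?_
  obtain ⟨e, he, hle⟩ := h (ε / (2 * C)) (by positivity)
  filter_upwards [hle, hvC.bound, he.def (half_pos hε)] with n hψ hvn hen
  calc ‖ψ n‖ ≤ ε / (2 * C) * (C * ‖a n‖) + ε / 2 * ‖a n‖ := by grw [hψ, hvn, hen]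
    _ = ε * ‖a n‖ := by field_simp; ring

theorem isLittleO_of_norm_le_comp_add {ψ : ι → E} {e : ι → F} {a : ι → G} {p : ι → ι} {q : ℝ}
    (hp : Tendsto p l l) (hq0 : 0 ≤ q) (hq1 : q < 1) (ha : ∀ᶠ n in l, ‖a (p n)‖ ≤ q * ‖a n‖)
    (hψ : ψ =O[l] a) (he : e =o[l] a) (h : ∀ᶠ n in l, ‖ψ n‖ ≤ ‖ψ (p n)‖ + ‖e n‖) :
    ψ =o[l] a := by
  obtain ⟨C, hC, hψC⟩ := hψ.exists_nonneg
  refine isLittleO_iff.2 fun ε hε => ?_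
  have iterate : ∀ j : ℕ, ∀ᶠ n in l, ‖ψ n‖ ≤ (C * q ^ j + ε / 2) * ‖a n‖ := by
    intro j
    induction j with
    | zero =>
      filter_upwards [hψC.bound] with n hn
      grw [hn, pow_zero, mul_one, ← half_pos hε, add_zero]
    | succ j ih =>
      have hδ : 0 < (1 - q) * (ε / 2) := mul_pos (sub_pos.2 hq1) (half_pos hε)
      filter_upwards [h, hp.eventually ih, ha, he.def hδ] with n hn ihn han hen
      calc ‖ψ n‖ ≤ (C * q ^ j + ε / 2) * (q * ‖a n‖) + (1 - q) * (ε / 2) * ‖a n‖ := by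
            grw [hn, ihn, han, hen]
        _ = (C * q ^ (j + 1) + ε / 2) * ‖a n‖ := by ring
  have hpow : Tendsto (fun j => C * q ^ j) atTop (𝓝 0) := by
    simpa using (tendsto_pow_atTop_nhds_zero_of_lt_one hq0 hq1).const_mul C
  obtain ⟨j, hj⟩ := (hpow.eventually_lt_const (half_pos hε)).exists
  filter_upwards [iterate j] with n hn
  grw [hn, hj, add_halves]

theorem isLittleO_sum_Icc_sub_sum_range {φ : ℕ → E} {a : ℕ → ℝ}
    (hφ : φ =O[atTop] fun _ => (1 : ℝ)) (ha : Tendsto a atTop atTop) :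
    (fun n => ∑ k ∈ Finset.Icc 1 n, φ k - ∑ k ∈ Finset.range n, φ k) =o[atTop] a := by
  have hboundary : ∀ n,
      ∑ k ∈ Finset.Icc 1 n, φ k - ∑ k ∈ Finset.range n, φ k = φ n - φ 0 := fun n => by
    rw [sub_eq_sub_iff_add_eq_add, ← Finset.sum_range_succ_comm, Finset.range_eq_Ico,
      Finset.sum_eq_sum_Ico_succ_bot n.succ_pos, add_comm]
    rfl
  have hone : (fun _ : ℕ => (1 : ℝ)) =o[atTop] a :=
    isLittleO_const_left.2 (Or.inr (tendsto_norm_atTop_atTop.comp ha))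
  simp_rw [hboundary]
  exact (hφ.sub (isBigO_const_const (φ 0) one_ne_zero atTop)).trans_isLittleO hone

theorem eventually_le_mul_and_le_mul_of_isEquivalent {a b : ι → ℝ} {s : ℝ} (hab : a ~[l] b)
    (hb : ∀ᶠ n in l, 0 ≤ b n) (hs : 1 < s) : ∀ᶠ n in l, a n ≤ s * b n ∧ b n ≤ s * a n := by
  have hinv : 0 < 1 - s⁻¹ := sub_pos.2 (inv_lt_one_of_one_lt₀ hs)
  filter_upwards [hab.isLittleO.def hinv, hb] with n hn hbn
  rw [Pi.sub_apply, Real.norm_eq_abs, Real.norm_of_nonneg hbn, abs_le] at hn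
  have hs0 : 0 < s := one_pos.trans hs
  constructor
  · have hfactor : 2 - s⁻¹ ≤ s := by
      rw [sub_le_iff_le_add, ← sub_nonneg]
      have : s + s⁻¹ - 2 = (s - 1) ^ 2 / s := by field_simp; ring
      rw [this]
      positivity
    nlinarith [mul_le_mul_of_nonneg_right hfactor hbn]
  · have : s⁻¹ * b n ≤ a n := by linarith
    rwa [inv_mul_le_iff₀ hs0] at this

end Asymptotics

section Windows

variable {a b : ℕ → ℝ} {K : ℝ}

theorem exists_index_at_scale (hmono : Monotone b) (hb : Tendsto b atTop atTop)
    (hK : ∀ n, b (n + 1) ≤ b n + K) {s : ℝ} (hs : 1 < s) :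
    ∃ p : ℕ → ℕ, Tendsto p atTop atTop ∧
      ∀ᶠ n in atTop, p n ≤ n ∧ b n ≤ s * b (p n) ∧ b (p n) ≤ s⁻¹ * b n + K := by
  have hs0 : 0 < s := one_pos.trans hs
  let p : ℕ → ℕ := fun n => sInf {k | b n ≤ s * b k}
  have hp : ∀ n, b n ≤ s * b (p n) := fun n =>
    Nat.sInf_mem ((hb.const_mul_atTop hs0).eventually_ge_atTop (b n)).exists
  refine ⟨p, tendsto_atTop.2 fun N => ?_, ?_⟩
  · filter_upwards [hb.eventually_gt_atTop (s * b N)] with n hn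
    exact (hmono.reflect_lt (lt_of_mul_lt_mul_left (hn.trans_le (hp n)) hs0.le)).le
  · filter_upwards [hb.eventually_ge_atTop 0, hb.eventually_ge_atTop (s * (b 0 - K))]
      with n hn0 hnK
    refine ⟨Nat.sInf_le (le_mul_of_one_le_left hn0 hs.le), hp n, ?_⟩
    rcases h : p n with _ | j
    · have : b 0 - K ≤ s⁻¹ * b n := (le_inv_mul_iff₀ hs0).2 hnK
      linarith
    · have hj : s * b j < b n := not_le.1 (Nat.notMem_of_lt_sInf (show j < p n by omega))
      have : b j < s⁻¹ * b n := (lt_inv_mul_iff₀ hs0).2 hj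
      linarith [hK j]

theorem exists_comparable_window (hmono : Monotone b) (hb : Tendsto b atTop atTop)
    (hK : ∀ n, b (n + 1) ≤ b n + K) (hab : a ~[atTop] b) {ρ : ℝ} (hρ : 1 < ρ) :
    ∃ (p : ℕ → ℕ) (q : ℝ), 0 ≤ q ∧ q < 1 ∧ Tendsto p atTop atTop ∧
      ∀ᶠ n in atTop, p n ≤ n ∧ b (p n) ≤ q * b n ∧
        ∀ k, p n ≤ k → k ≤ n → a n ≤ ρ * a k ∧ a k ≤ ρ * a (p n) := by
  obtain ⟨s, hs, rfl⟩ : ∃ s : ℝ, 1 < s ∧ s ^ 3 = ρ :=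
    ⟨ρ ^ ((3 : ℕ) : ℝ)⁻¹, Real.one_lt_rpow hρ (by positivity),
      Real.rpow_inv_natCast_pow (by positivity) three_ne_zero⟩
  have : 0 < s := one_pos.trans hs
  have hs1 : s⁻¹ < 1 := inv_lt_one_of_one_lt₀ hs
  obtain ⟨p, hp, hpb⟩ := exists_index_at_scale hmono hb hK hs
  obtain ⟨N, hN⟩ := eventually_atTop.1
    (eventually_le_mul_and_le_mul_of_isEquivalent hab (hb.eventually_ge_atTop 0) hs)
  refine ⟨p, (1 + s⁻¹) / 2, by positivity, by linarith, hp, ?_⟩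
  filter_upwards [hpb, hp.eventually_ge_atTop N,
    hb.eventually_ge_atTop (K / ((1 - s⁻¹) / 2))] with n ⟨hpn, hnp, hpK⟩ hNp hnK
  refine ⟨hpn, ?_, fun k hpk hkn => ⟨?_, ?_⟩⟩
  · rw [div_le_iff₀ (by linarith)] at hnK
    linarith
  · calc a n ≤ s * (s * (s * a k)) := by
          grw [(hN n (hNp.trans hpn)).1, hnp, hmono hpk, (hN k (hNp.trans hpk)).2]
      _ = s ^ 3 * a k := by ring
  · calc a k ≤ s * (s * (s * a (p n))) := by
          grw [(hN k (hNp.trans hpk)).1, hmono hkn, hnp, (hN (p n) hNp).2]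
      _ = s ^ 3 * a (p n) := by ring

theorem exists_abs_div_sub_lt_of_sandwich (c : ℝ) {ε : ℝ} (hε : 0 < ε) :
    ∃ ρ > 1, ∃ t > 0, ∀ S₁ S S₂ α₁ α α₂ : ℝ, 0 ≤ S₁ → S₁ ≤ S → S ≤ S₂ →
      0 < α₁ → 0 < α → 0 < α₂ → α₂ ≤ ρ * α → α ≤ ρ * α₁ →
      |S₁ / α₁ - c| < t → |S₂ / α₂ - c| < t → |S / α - c| < ε := by
  have hupper : Tendsto (fun t : ℝ => (1 + t) * (c + t)) (𝓝[>] 0) (𝓝 c) := by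
    have : Continuous fun t : ℝ => (1 + t) * (c + t) := by fun_prop
    simpa using (this.tendsto 0).mono_left nhdsWithin_le_nhds
  have hlower : Tendsto (fun t : ℝ => (1 + t)⁻¹ * (c - t)) (𝓝[>] 0) (𝓝 c) := by
    have : ContinuousAt (fun t : ℝ => (1 + t)⁻¹ * (c - t)) 0 := by fun_prop (disch := norm_num)
    simpa using this.tendsto.mono_left nhdsWithin_le_nhds
  obtain ⟨t, htu, htl, ht⟩ := ((hupper.eventually_lt_const (lt_add_of_pos_right c hε)).and
    ((hlower.eventually_const_lt (sub_lt_self c hε)).and self_mem_nhdsWithin)).exists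
  have ht0 : 0 < t := ht
  refine ⟨1 + t, by linarith, t, ht0,
    fun S₁ S S₂ α₁ α α₂ hS₁ h₁ h₂ hα₁ hα hα₂ hα₂α hαα₁ hl hu => ?_⟩
  rw [abs_lt] at hl hu ⊢
  have hSu : S / α ≤ (1 + t) * (S₂ / α₂) := by
    rw [← mul_div_assoc, div_le_div_iff₀ hα hα₂]
    calc S * α₂ ≤ S₂ * ((1 + t) * α) := by
          gcongr
          linarith
      _ = (1 + t) * S₂ * α := by ring
  have hSl : (1 + t)⁻¹ * (S₁ / α₁) ≤ S / α := by
    rw [inv_mul_le_iff₀ (by positivity), ← mul_div_assoc, div_le_div_iff₀ hα₁ hα]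
    calc S₁ * α ≤ S * ((1 + t) * α₁) := by gcongr; linarith
      _ = (1 + t) * S * α₁ := by ring
  have hu' : (1 + t) * (S₂ / α₂) < (1 + t) * (c + t) := by gcongr; linarith
  have hl' : (1 + t)⁻¹ * (c - t) < (1 + t)⁻¹ * (S₁ / α₁) := by gcongr; linarith
  constructor <;> linarith

end Windows

theorem tendsto_setIntegral_zero_of_tendstoInMeasure_const {ι Ω : Type*} {l : Filter ι}
    [MeasurableSpace Ω] {μ : Measure Ω} [IsFiniteMeasure μ] {h : ι → Ω → ℝ} {c : ℝ}
    {E : ι → Set Ω} (hint : ∀ n, Integrable (h n) μ) (hnonneg : ∀ᶠ n in l, 0 ≤ᵐ[μ] h n)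
    (hlim : TendstoInMeasure μ h l fun _ => c)
    (hI : Tendsto (fun n => ∫ x, h n x ∂μ) l (𝓝 (c * μ.real Set.univ)))
    (hE : Tendsto (fun n => μ.real (E n)) l (𝓝 0)) :
    Tendsto (fun n => ∫ x in E n, h n x ∂μ) l (𝓝 0) := by
  rw [tendstoInMeasure_iff_measureReal_norm] at hlim
  refine tendsto_order.2 ⟨fun r hr => ?_, fun ε hε => ?_⟩
  · filter_upwards [hnonneg] with n hn
    exact hr.trans_le (integral_nonneg_of_ae (ae_restrict_of_ae hn))
  obtain ⟨δ, hδ, hδε⟩ : ∃ δ > 0, μ.real Set.univ * δ < ε := exists_pos_mul_lt hε _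
  let bad : ι → Set Ω := fun n => toMeasurable μ (E n ∪ {x | δ ≤ ‖h n x - c‖})
  have hbad : Tendsto (fun n => μ.real (bad n)) l (𝓝 0) := by
    refine squeeze_zero (fun _ => measureReal_nonneg) (fun n => ?_)
      (by simpa only [add_zero] using hE.add (hlim δ hδ))
    rw [measureReal_def, measure_toMeasurable]
    exact measureReal_union_le _ _
  have hgood : ∀ n, (c - δ) * (μ.real Set.univ - μ.real (bad n)) ≤ ∫ x in (bad n)ᶜ, h n x ∂μ := by
    intro n
    have hm : MeasurableSet (bad n) := measurableSet_toMeasurable _ _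
    rw [← measureReal_compl hm, mul_comm, ← smul_eq_mul, ← setIntegral_const]
    refine setIntegral_mono_on (integrable_const _).integrableOn (hint n).integrableOn hm.compl
      fun x hx => ?_
    have hxD : ¬ δ ≤ ‖h n x - c‖ := fun hD => hx (subset_toMeasurable _ _ (Or.inr hD))
    rw [Real.norm_eq_abs, not_le, abs_lt] at hxD
    linarith
  have hbound : Tendsto (fun n => ∫ x, h n x ∂μ - (c - δ) * (μ.real Set.univ - μ.real (bad n))) l
      (𝓝 (μ.real Set.univ * δ)) := by
    convert hI.sub ((hbad.const_sub _).const_mul (c - δ)) using 2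
    ring
  filter_upwards [hnonneg, hbound.eventually_lt_const hδε] with n hn hlt
  calc ∫ x in E n, h n x ∂μ ≤ ∫ x in bad n, h n x ∂μ :=
        setIntegral_mono_set (hint n).integrableOn (ae_restrict_of_ae hn)
          (Set.subset_union_left.trans (subset_toMeasurable _ _)).eventuallyLE
    _ = ∫ x, h n x ∂μ - ∫ x in (bad n)ᶜ, h n x ∂μ :=
        eq_sub_of_add_eq (integral_add_compl (measurableSet_toMeasurable _ _) (hint n))
    _ < ε := by linarith [hgood n]

theorem abs_setIntegral_comp_sub_le {Ω Y : Type*} [MeasurableSpace Ω] [PseudoMetricSpace Y]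
    {μ : Measure Ω} {s : Set Ω} (G : Y →ᵇ ℝ) {h : Ω → Y} (hh : AEStronglyMeasurable h μ)
    (hs : μ s ≠ ⊤) {c : Y} {ε w : ℝ} (hw : 0 ≤ w)
    (hG : ∀ y, dist y c < ε → dist (G y) (G c) ≤ w) :
    |∫ x in s, G (h x) ∂μ - μ.real s * G c|
      ≤ w * μ.real s + 2 * ‖G‖ * μ.real (s ∩ {x | ε ≤ dist (h x) c}) := by
  have := isFiniteMeasure_restrict.2 hs
  let D : Set Ω := {x | ε ≤ dist (h x) c}
  have hD : NullMeasurableSet D (μ.restrict s) :=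
    nullMeasurableSet_le aemeasurable_const
      (hh.restrict.dist aestronglyMeasurable_const).aemeasurable
  have hpoint : ∀ x, ‖G (h x) - G c‖ ≤ w + D.indicator (fun _ => 2 * ‖G‖) x := fun x => by
    rw [← dist_eq_norm]
    by_cases hx : x ∈ D
    · rw [Set.indicator_of_mem hx]
      exact (G.dist_le_two_norm _ _).trans (le_add_of_nonneg_left hw)
    · rw [Set.indicator_of_notMem hx, add_zero]
      exact hG _ (not_le.1 hx)
  have hGint : Integrable (fun x => G (h x)) (μ.restrict s) :=
    .of_bound (G.continuous.comp_aestronglyMeasurable hh.restrict) ‖G‖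
      (.of_forall fun x => G.norm_coe_le_norm _)
  have hIint : Integrable (D.indicator fun _ => 2 * ‖G‖) (μ.restrict s) :=
    (integrable_const _).indicator₀ hD
  calc |∫ x in s, G (h x) ∂μ - μ.real s * G c| = ‖∫ x in s, (G (h x) - G c) ∂μ‖ := by
        rw [integral_sub hGint (integrable_const _), setIntegral_const, smul_eq_mul,
          Real.norm_eq_abs]
    _ ≤ ∫ x in s, (w + D.indicator (fun _ => 2 * ‖G‖) x) ∂μ :=
        norm_integral_le_of_norm_le ((integrable_const w).add hIint) (.of_forall hpoint)
    _ = w * μ.real s + 2 * ‖G‖ * μ.real (s ∩ D) := by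
        rw [integral_add (integrable_const w) hIint, integral_indicator₀ hD, setIntegral_const,
          setIntegral_const, measureReal_restrict_apply₀ hD, Set.inter_comm, smul_eq_mul,
          smul_eq_mul, mul_comm w, mul_comm (2 * ‖G‖)]

theorem exists_measure_ne_zero_ne_top {X : Type*} [MeasurableSpace X] (m : Measure X)
    [SigmaFinite m] (hm : m ≠ 0) : ∃ s, m s ≠ 0 ∧ m s ≠ ⊤ := by
  obtain ⟨n, hn⟩ := exists_measure_pos_of_not_measure_iUnion_null (μ := m) (s := spanningSets m)
    (by rwa [iUnion_spanningSets, ne_eq, Measure.measure_univ_eq_zero])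
  exact ⟨spanningSets m n, hn.ne', (measure_spanningSets_lt_top m n).ne⟩

section Systems

variable {X : Type*} [MeasurableSpace X] {m : Measure X} {T : X → X} {R R' : Set (Set X)}
  {a u : ℕ → ℝ} {A B C E F s : Set X} {f : X → ℝ}

namespace IsDenseInvariantHereditaryRing

theorem measure_ne_top (hR : IsDenseInvariantHereditaryRing m T R) (hA : A ∈ R) : m A ≠ ⊤ :=
  (hR.measure_lt_top A hA).ne

theorem integrable_indicator_one (hR : IsDenseInvariantHereditaryRing m T R) (hA : A ∈ R) :
    Integrable (A.indicator fun _ => (1 : ℝ)) m :=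
  (integrableOn_const (hR.measure_ne_top hA)).integrable_indicator (hR.measurableSet A hA)

theorem sdiff_mem (hR : IsDenseInvariantHereditaryRing m T R) (hA : A ∈ R)
    (hB : MeasurableSet B) : A \ B ∈ R :=
  hR.hereditary A hA _ ((hR.measurableSet A hA).diff hB) Set.sdiff_subset

theorem exists_subset_sdiff_lt (hR : IsDenseInvariantHereditaryRing m T R)
    (hs : MeasurableSet s) (hst : m s ≠ ⊤) {ε : ℝ} (hε : 0 < ε) :
    ∃ A ∈ R, A ⊆ s ∧ m.real (s \ A) < ε := by
  obtain ⟨A, hA, hsA⟩ := hR.dense s hs hst.lt_top (ENNReal.ofReal ε) (by simpa using hε)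
  refine ⟨s ∩ A, hR.hereditary A hA _ (hs.inter (hR.measurableSet A hA)) Set.inter_subset_right,
    Set.inter_subset_left, ENNReal.toReal_lt_of_lt_ofReal ?_⟩
  rw [Set.sdiff_self_inter]
  exact (measure_mono Set.subset_union_left).trans_lt hsA

theorem exists_subset_measureReal_pos (hR : IsDenseInvariantHereditaryRing m T R)
    (hs : MeasurableSet s) (hst : m s ≠ ⊤) (hs0 : 0 < m.real s) :
    ∃ A ∈ R, A ⊆ s ∧ 0 < m.real A := by
  obtain ⟨A, hA, hAs, hlt⟩ := hR.exists_subset_sdiff_lt hs hst hs0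
  rw [measureReal_sdiff hAs (hR.measurableSet A hA) hst] at hlt
  exact ⟨A, hA, hAs, by linarith⟩

theorem exists_measureReal_pos (hR : IsDenseInvariantHereditaryRing m T R)
    (hm : ∃ s, m s ≠ 0 ∧ m s ≠ ⊤) : ∃ A ∈ R, 0 < m.real A := by
  obtain ⟨s, hs0, hst⟩ := hm
  rw [← measure_toMeasurable] at hs0 hst
  obtain ⟨A, hA, -, hA0⟩ := hR.exists_subset_measureReal_pos (measurableSet_toMeasurable m s) hst
    (ENNReal.toReal_pos hs0 hst)
  exact ⟨A, hA, hA0⟩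

theorem exists_mem_inter_measureReal_pos (hR : IsDenseInvariantHereditaryRing m T R)
    (hR' : IsDenseInvariantHereditaryRing m T R') (hm : ∃ s, m s ≠ 0 ∧ m s ≠ ⊤) :
    ∃ A ∈ R ∩ R', 0 < m.real A := by
  obtain ⟨B, hB, hB0⟩ := hR.exists_measureReal_pos hm
  obtain ⟨A, hA, hAB, hA0⟩ := hR'.exists_subset_measureReal_pos (hR.measurableSet B hB)
    (hR.measure_ne_top hB) hB0
  exact ⟨A, ⟨hR.hereditary B hB A (hR'.measurableSet A hA) hAB, hA⟩, hA0⟩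

end IsDenseInvariantHereditaryRing

section VisitSum

/-- The integral over `x ∈ A` of the number of times `k < n` at which the orbit of `x` visits `B`,
i.e. `∑_{k < n} m(A ∩ T⁻ᵏ B)`; time `0` is included. -/
noncomputable def visitSum (m : Measure X) (T : X → X) (A B : Set X) (n : ℕ) : ℝ :=
  ∑ k ∈ Finset.range n, m.real (A ∩ T^[k] ⁻¹' B)

theorem visitSum_nonneg (m : Measure X) (T : X → X) (A B : Set X) (n : ℕ) :
    0 ≤ visitSum m T A B n :=
  Finset.sum_nonneg fun _ _ => measureReal_nonneg

theorem monotone_visitSum (m : Measure X) (T : X → X) (A B : Set X) :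
    Monotone (visitSum m T A B) :=
  monotone_nat_of_le_succ fun n => by
    rw [visitSum, visitSum, Finset.sum_range_succ]
    exact le_add_of_nonneg_right measureReal_nonneg

theorem visitSum_succ_le (hA : m A ≠ ⊤) (n : ℕ) :
    visitSum m T A B (n + 1) ≤ visitSum m T A B n + m.real A := by
  rw [visitSum, visitSum, Finset.sum_range_succ]
  gcongr
  exact Set.inter_subset_left

theorem visitSum_preimage_right (n : ℕ) :
    visitSum m T A (T ⁻¹' B) n = visitSum m T A B (n + 1) - m.real (A ∩ B) := by
  rw [eq_sub_iff_add_eq, visitSum, visitSum, Finset.sum_range_succ']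
  simp only [Function.iterate_succ', Set.preimage_comp, Function.iterate_zero, Set.preimage_id]

end VisitSum

section BirkhoffSum

theorem integrable_birkhoffSum (hT : MeasurePreserving T m m) (hf : Integrable f m) (n : ℕ) :
    Integrable (birkhoffSum T f n) m :=
  integrable_finsetSum _ fun k _ => (hT.iterate k).integrable_comp_of_integrable hf

theorem setIntegral_birkhoffSum_indicator (hT : MeasurePreserving T m m) (hB : MeasurableSet B)
    (hBt : m B ≠ ⊤) (n : ℕ) :
    ∫ x in A, birkhoffSum T (B.indicator fun _ => (1 : ℝ)) n x ∂m = visitSum m T A B n := by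
  have hBint : Integrable (B.indicator fun _ => (1 : ℝ)) m :=
    (integrableOn_const hBt).integrable_indicator hB
  unfold birkhoffSum visitSum
  rw [integral_finsetSum (f := fun k x => B.indicator _ (T^[k] x)) _ fun k _ =>
    ((hT.iterate k).integrable_comp_of_integrable hBint).integrableOn]
  refine Finset.sum_congr rfl fun k _ => ?_
  have hk : MeasurableSet (T^[k] ⁻¹' B) := (hT.iterate k).measurable hB
  rw [Set.inter_comm, ← measureReal_restrict_apply hk, ← integral_indicator_one hk]
  rfl

theorem ae_monotone_birkhoffSum (hT : MeasurePreserving T m m) (hf : 0 ≤ᵐ[m] f) :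
    ∀ᵐ x ∂m, Monotone fun n => birkhoffSum T f n x := by
  have hiter : ∀ᵐ x ∂m, ∀ k, 0 ≤ f (T^[k] x) :=
    ae_all_iff.2 fun k => (hT.iterate k).quasiMeasurePreserving.ae hf
  filter_upwards [hiter] with x hx
  exact monotone_nat_of_le_succ fun n => by
    rw [birkhoffSum_succ]
    exact le_add_of_nonneg_right (hx n)

/-- The weak law of large numbers for `f`: `S_n(f) / a(n) → m(f)` in measure on every set of finite
measure. -/
def SatisfiesWeakLaw (m : Measure X) (T : X → X) (a : ℕ → ℝ) (f : X → ℝ) : Prop :=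
  TendstoInMeasureOnFinite m (fun n x => birkhoffSum T f n x / a n) fun _ => ∫ x, f x ∂m

/-- The set of points whose normalized Birkhoff sum `S_n(f) / a(n)` is at distance at least `ε`
from its weak limit `m(f)`. -/
def deviationSet (m : Measure X) (T : X → X) (a : ℕ → ℝ) (f : X → ℝ) (ε : ℝ) (n : ℕ) : Set X :=
  {x | ε ≤ |birkhoffSum T f n x / a n - ∫ y, f y ∂m|}

theorem SatisfiesWeakLaw.tendsto_measureReal_inter_deviationSet (hf : SatisfiesWeakLaw m T a f)
    (hA : MeasurableSet A) (hAt : m A ≠ ⊤) {ε : ℝ} (hε : 0 < ε) :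
    Tendsto (fun n => m.real (A ∩ deviationSet m T a f ε n)) atTop (𝓝 0) := by
  have := isFiniteMeasure_restrict.2 hAt
  refine (tendstoInMeasure_iff_measureReal_norm.1 (hf A hA hAt.lt_top) ε hε).congr fun n => ?_
  rw [measureReal_restrict_apply' hA, Set.inter_comm]
  rfl

theorem exists_ae_deviationSet_subset_union (hT : MeasurePreserving T m m)
    (ha : ∀ n, 1 ≤ n → 0 < a n) (hf : 0 ≤ᵐ[m] f) {ε : ℝ} (hε : 0 < ε) :
    ∃ ρ > 1, ∃ t > 0, ∀ p k n, 1 ≤ p → p ≤ k → k ≤ n → a n ≤ ρ * a k → a k ≤ ρ * a p →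
      deviationSet m T a f ε k ≤ᵐ[m]
        (deviationSet m T a f t p ∪ deviationSet m T a f t n : Set X) := by
  obtain ⟨ρ, hρ, t, ht, hsandwich⟩ := exists_abs_div_sub_lt_of_sandwich (∫ x, f x ∂m) hε
  refine ⟨ρ, hρ, t, ht, fun p k n hp hpk hkn hnk hkp => ?_⟩
  filter_upwards [ae_monotone_birkhoffSum hT hf] with x hx hxk
  by_contra hout
  obtain ⟨hxp, hxn⟩ := not_or.1 hout
  have hxp0 : 0 ≤ birkhoffSum T f p x := hx p.zero_le
  exact (hsandwich _ _ _ _ _ _ hxp0 (hx hpk) (hx hkn) (ha p hp) (ha k (by omega))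
    (ha n (by omega)) hnk hkp (not_le.1 hxp) (not_le.1 hxn)).not_ge hxk

end BirkhoffSum

section DeviantVisitSum

variable {ε : ℝ}

/-- The part of `visitSum m T A B n` contributed by the times `k` and the starting points at which
`S_k(f) / a(k)` is at distance at least `ε` from `m(f)`. -/
noncomputable def deviantVisitSum (m : Measure X) (T : X → X) (a : ℕ → ℝ) (f : X → ℝ) (ε : ℝ)
    (A B : Set X) (n : ℕ) : ℝ :=
  ∑ k ∈ Finset.range n, m.real (A ∩ deviationSet m T a f ε k ∩ T^[k] ⁻¹' B)

theorem norm_deviantVisitSum (n : ℕ) :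
    ‖deviantVisitSum m T a f ε A B n‖ = deviantVisitSum m T a f ε A B n :=
  Real.norm_of_nonneg (Finset.sum_nonneg fun _ _ => measureReal_nonneg)

theorem deviantVisitSum_le_visitSum (hAt : m A ≠ ⊤) (n : ℕ) :
    deviantVisitSum m T a f ε A B n ≤ visitSum m T A B n :=
  Finset.sum_le_sum fun _ _ => measureReal_mono
    (Set.inter_subset_inter_left _ Set.inter_subset_left)
    (measure_ne_top_of_subset Set.inter_subset_left hAt)

theorem deviantVisitSum_le_add_visitSum (hAt : m A ≠ ⊤) {p n : ℕ} (hpn : p ≤ n)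
    (hE : ∀ k, p ≤ k → k ≤ n → deviationSet m T a f ε k ≤ᵐ[m] E) :
    deviantVisitSum m T a f ε A B n
      ≤ deviantVisitSum m T a f ε A B p + visitSum m T (A ∩ E) B n := by
  have hterm : ∀ k ∈ Finset.Ico p n, m.real (A ∩ deviationSet m T a f ε k ∩ T^[k] ⁻¹' B)
      ≤ m.real (A ∩ E ∩ T^[k] ⁻¹' B) := fun k hk => by
    obtain ⟨hpk, hkn⟩ := Finset.mem_Ico.1 hk
    refine ENNReal.toReal_mono (measure_ne_top_of_subset ?_ hAt) (measure_mono_ae ?_)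
    · exact Set.inter_subset_left.trans Set.inter_subset_left
    · exact ((EventuallyLE.refl _ A).inter (hE k hpk hkn.le)).inter (EventuallyLE.refl _ _)
  have hIco : Finset.Ico p n ⊆ Finset.range n := fun k hk =>
    Finset.mem_range.2 (Finset.mem_Ico.1 hk).2
  rw [deviantVisitSum, ← Finset.sum_range_add_sum_Ico _ hpn]
  exact add_le_add_right ((Finset.sum_le_sum hterm).trans
    (Finset.sum_le_sum_of_subset_of_nonneg hIco fun _ _ _ => measureReal_nonneg)) _

end DeviantVisitSum

namespace IsWeaklyRationallyErgodic

theorem eventually_ne_zero (hT : IsWeaklyRationallyErgodic m T R a) : ∀ᶠ n in atTop, a n ≠ 0 :=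
  (eventually_ge_atTop 1).mono fun n hn => (hT.pos n hn).ne'

theorem isLittleO_visitSum_sub (hT : IsWeaklyRationallyErgodic m T R a) (hA : A ∈ R)
    (hB : B ∈ R) :
    (fun n => visitSum m T A B n - m.real A * m.real B * a n) =o[atTop] a := by
  refine (isLittleO_iff_tendsto' (hT.eventually_ne_zero.mono fun _ hn h0 => absurd h0 hn)).2 ?_
  have h := (hT.tendsto A hA B hB).sub_const (m.real A * m.real B)
  rw [sub_self] at h
  refine h.congr' (hT.eventually_ne_zero.mono fun n hn => ?_)
  unfold visitSum
  field_simp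

theorem isBigO_visitSum (hT : IsWeaklyRationallyErgodic m T R a) (hA : A ∈ R) (hB : B ∈ R) :
    visitSum m T A B =O[atTop] a := by
  simpa only [sub_add_cancel] using (hT.isLittleO_visitSum_sub hA hB).isBigO.add
    ((isBigO_refl a atTop).const_mul_left (m.real A * m.real B))

theorem isEquivalent_visitSum (hT : IsWeaklyRationallyErgodic m T R a) (hA : A ∈ R) (hB : B ∈ R)
    (hA0 : 0 < m.real A) (hB0 : 0 < m.real B) :
    visitSum m T A B ~[atTop] fun n => m.real A * m.real B * a n :=
  (isLittleO_const_mul_right_iff (mul_pos hA0 hB0).ne').2 (hT.isLittleO_visitSum_sub hA hB)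

theorem exists_monotone_isEquivalent (hT : IsWeaklyRationallyErgodic m T R a)
    (hm : ∃ s, m s ≠ 0 ∧ m s ≠ ⊤) :
    ∃ (b : ℕ → ℝ) (K : ℝ), Monotone b ∧ (∀ n, b (n + 1) ≤ b n + K) ∧ a ~[atTop] b := by
  obtain ⟨A, hA, hA0⟩ := hT.ring.exists_measureReal_pos hm
  have hc : 0 < (m.real A * m.real A)⁻¹ := by positivity
  refine ⟨fun n => (m.real A * m.real A)⁻¹ * visitSum m T A A n,
    (m.real A * m.real A)⁻¹ * m.real A, (monotone_visitSum m T A A).const_mul hc.le,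
    fun n => ?_, ?_⟩
  · rw [← mul_add]
    exact mul_le_mul_of_nonneg_left (visitSum_succ_le (hT.ring.measure_ne_top hA) n) hc.le
  · have hequiv := (IsEquivalent.refl (u := fun _ : ℕ => (m.real A * m.real A)⁻¹)).mul
      (hT.isEquivalent_visitSum hA hA hA0 hA0).symm
    refine hequiv.congr_left (.of_forall fun n => ?_)
    exact inv_mul_cancel_left₀ (by positivity) (a n)

-- If `V n = ∑_{k < n} m(A ∩ T⁻ᵏ A)` had a finite limit `l`, then so would the visits from `A` to
-- `T⁻¹ A`, being asymptotic to `V`; but these are `V (n + 1) - m(A)`.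
theorem tendsto_atTop (hT : IsWeaklyRationallyErgodic m T R a) (hm : ∃ s, m s ≠ 0 ∧ m s ≠ ⊤) :
    Tendsto a atTop atTop := by
  obtain ⟨A, hA, hA0⟩ := hT.ring.exists_measureReal_pos hm
  have hpre : m.real (T ⁻¹' A) = m.real A :=
    hT.measurePreserving.measureReal_preimage (hT.ring.measurableSet A hA).nullMeasurableSet
  have hequiv := hT.isEquivalent_visitSum hA hA hA0 hA0
  rcases tendsto_atTop_of_monotone (monotone_visitSum m T A A) with hinf | ⟨l, hl⟩
  · exact (tendsto_const_mul_atTop_of_pos (mul_pos hA0 hA0)).1 (hequiv.tendsto_atTop hinf)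
  · have hpre_equiv : visitSum m T A (T ⁻¹' A) ~[atTop] visitSum m T A A := by
      have := hT.isEquivalent_visitSum hA (hT.ring.invariant A hA) hA0 (hpre.symm ▸ hA0)
      rw [hpre] at this
      exact this.trans hequiv.symm
    have hshift : Tendsto (visitSum m T A (T ⁻¹' A)) atTop (𝓝 (l - m.real A)) := by
      simp_rw [funext visitSum_preimage_right, Set.inter_self]
      exact ((tendsto_add_atTop_iff_nat 1).2 hl).sub_const _
    have := tendsto_nhds_unique hshift (hpre_equiv.symm.tendsto_nhds hl)
    linarith

theorem isLittleO_visitSum_of_tendsto_zero (hT : IsWeaklyRationallyErgodic m T R a)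
    (hlaw : SatisfiesWeakLaw m T a (B.indicator fun _ => 1)) (hA : A ∈ R) (hB : B ∈ R)
    {E : ℕ → Set X} (hEA : ∀ n, E n ⊆ A) (hE : Tendsto (fun n => m.real (E n)) atTop (𝓝 0)) :
    (fun n => visitSum m T (E n) B n) =o[atTop] a := by
  have hAm := hT.ring.measurableSet A hA
  have hAt := hT.ring.measure_ne_top hA
  have hBm := hT.ring.measurableSet B hB
  have hBt := hT.ring.measure_ne_top hB
  have hvisit : ∀ (s : Set X) n, ∫ x in s, birkhoffSum T (B.indicator fun _ => (1 : ℝ)) n x / a n ∂m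
      = visitSum m T s B n / a n := fun s n => by
    rw [integral_div, setIntegral_birkhoffSum_indicator hT.measurePreserving hBm hBt]
  have := isFiniteMeasure_restrict.2 hAt
  suffices hlim : Tendsto (fun n => ∫ x in E n,
      birkhoffSum T (B.indicator fun _ => (1 : ℝ)) n x / a n ∂m.restrict A) atTop (𝓝 0) by
    simp_rw [Measure.restrict_restrict_of_subset (hEA _), hvisit] at hlim
    exact (isLittleO_iff_tendsto' (hT.eventually_ne_zero.mono fun _ hn h0 => absurd h0 hn)).2 hlim
  refine tendsto_setIntegral_zero_of_tendstoInMeasure_const (c := m.real B) (fun n => ?_)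
    ?_ ?_ ?_ ?_
  · exact ((integrable_birkhoffSum hT.measurePreserving
      (hT.ring.integrable_indicator_one hB) n).div_const _).restrict
  · filter_upwards [eventually_ge_atTop 1] with n hn
    exact .of_forall fun x => div_nonneg
      (Finset.sum_nonneg fun _ _ => Set.indicator_nonneg (fun _ _ => zero_le_one) _)
      (hT.pos n hn).le
  · simpa only [integral_indicator_const _ hBm, smul_eq_mul, mul_one] using hlaw A hAm hAt.lt_top
  · simp_rw [hvisit, measureReal_restrict_apply_univ, div_eq_inv_mul, ← one_div,
      mul_comm (m.real B)]
    exact hT.tendsto A hA B hB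
  · simpa only [measureReal_restrict_apply' hAm, Set.inter_eq_left.2 (hEA _)] using hE

theorem isLittleO_deviantVisitSum (hT : IsWeaklyRationallyErgodic m T R a)
    (hm : ∃ s, m s ≠ 0 ∧ m s ≠ ⊤) (hf : SatisfiesWeakLaw m T a f) (hf0 : 0 ≤ᵐ[m] f)
    (hlaw : SatisfiesWeakLaw m T a (B.indicator fun _ => 1)) (hA : A ∈ R) (hB : B ∈ R)
    {ε : ℝ} (hε : 0 < ε) :
    deviantVisitSum m T a f ε A B =o[atTop] a := by
  have hAt := hT.ring.measure_ne_top hA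
  obtain ⟨ρ, hρ, t, ht, hsub⟩ :=
    exists_ae_deviationSet_subset_union hT.measurePreserving hT.pos hf0 hε
  obtain ⟨b, K, hmono, hK, hab⟩ := hT.exists_monotone_isEquivalent hm
  have hb : Tendsto b atTop atTop := hab.tendsto_atTop (hT.tendsto_atTop hm)
  obtain ⟨p, q, hq0, hq1, hp, hwindow⟩ := exists_comparable_window hmono hb hK hab hρ
  let E : ℕ → Set X := fun n => deviationSet m T a f t (p n) ∪ deviationSet m T a f t n
  have hE : Tendsto (fun n => m.real (A ∩ E n)) atTop (𝓝 0) := by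
    have hD := hf.tendsto_measureReal_inter_deviationSet (hT.ring.measurableSet A hA) hAt ht
    have hDp := (hD.comp hp).add hD
    rw [add_zero] at hDp
    refine squeeze_zero (fun _ => measureReal_nonneg) (fun n => ?_) hDp
    simp only [E, Set.inter_union_distrib_left]
    exact measureReal_union_le _ _
  have hvisit : (fun n => visitSum m T (A ∩ E n) B n) =o[atTop] b :=
    (hT.isLittleO_visitSum_of_tendsto_zero hlaw hA hB (fun _ => Set.inter_subset_left)
      hE).trans_isBigO hab.isBigO
  have hbound : deviantVisitSum m T a f ε A B =O[atTop] b :=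
    (IsBigO.of_norm_le fun n => (norm_deviantVisitSum n).trans_le
      (deviantVisitSum_le_visitSum hAt n)).trans ((hT.isBigO_visitSum hA hB).trans hab.isBigO)
  refine (isLittleO_of_norm_le_comp_add hp hq0 hq1 ?_ hbound hvisit ?_).trans_isBigO hab.symm.isBigO
  · filter_upwards [hwindow, hb.eventually_ge_atTop 0, hp.eventually (hb.eventually_ge_atTop 0)]
      with n hn hbn hbp
    rw [Real.norm_of_nonneg hbn, Real.norm_of_nonneg hbp]
    exact hn.2.1
  · filter_upwards [hwindow, hp.eventually_ge_atTop 1] with n ⟨hpn, _, hcomp⟩ hp1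
    rw [norm_deviantVisitSum, norm_deviantVisitSum, Real.norm_of_nonneg (visitSum_nonneg m T _ B n)]
    exact deviantVisitSum_le_add_visitSum hAt hpn fun k hpk hkn =>
      hsub (p n) k n hp1 hpk hkn (hcomp k hpk hkn).1 (hcomp k hpk hkn).2

theorem isLittleO_sum_range_setIntegral_sub (hT : IsWeaklyRationallyErgodic m T R a)
    (hm : ∃ s, m s ≠ 0 ∧ m s ≠ ⊤) (hfi : Integrable f m) (hf : SatisfiesWeakLaw m T a f)
    (hf0 : 0 ≤ᵐ[m] f) (hlaw : SatisfiesWeakLaw m T a (B.indicator fun _ => 1)) (hA : A ∈ R)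
    (hB : B ∈ R) (G : ℝ →ᵇ ℝ) :
    (fun n => ∑ k ∈ Finset.range n, |∫ x in A ∩ T^[k] ⁻¹' B, G (birkhoffSum T f k x / a k) ∂m
      - m.real (A ∩ T^[k] ⁻¹' B) * G (∫ x, f x ∂m)|) =o[atTop] a := by
  refine isLittleO_of_forall_norm_le_mul_add (hT.isBigO_visitSum hA hB) fun w hw => ?_
  obtain ⟨ε, hε, hGε⟩ := Metric.continuous_iff.1 G.continuous (∫ x, f x ∂m) w hw
  refine ⟨fun n => 2 * ‖G‖ * deviantVisitSum m T a f ε A B n,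
    (hT.isLittleO_deviantVisitSum hm hf hf0 hlaw hA hB hε).const_mul_left _, .of_forall fun n => ?_⟩
  rw [Real.norm_of_nonneg (Finset.sum_nonneg fun _ _ => abs_nonneg _),
    Real.norm_of_nonneg (visitSum_nonneg m T A B n), norm_mul, norm_deviantVisitSum,
    Real.norm_of_nonneg (by positivity), visitSum, deviantVisitSum, Finset.mul_sum, Finset.mul_sum,
    ← Finset.sum_add_distrib]
  refine Finset.sum_le_sum fun k _ => ?_
  rw [Set.inter_right_comm]
  exact abs_setIntegral_comp_sub_le G
    ((integrable_birkhoffSum hT.measurePreserving hfi k).div_const _).aestronglyMeasurable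
    (measure_ne_top_of_subset Set.inter_subset_left (hT.ring.measure_ne_top hA))
    hw.le fun y hy => (hGε y hy).le

theorem isLittleO_sum_Icc_setIntegral_sub (hT : IsWeaklyRationallyErgodic m T R a)
    (hm : ∃ s, m s ≠ 0 ∧ m s ≠ ⊤) (hfi : Integrable f m) (hf : SatisfiesWeakLaw m T a f)
    (hf0 : 0 ≤ᵐ[m] f) (hlaw : SatisfiesWeakLaw m T a (B.indicator fun _ => 1)) (hA : A ∈ R)
    (hB : B ∈ R) (G : ℝ →ᵇ ℝ) :
    (fun n => ∑ k ∈ Finset.Icc 1 n, |∫ x in A ∩ T^[k] ⁻¹' B, G (birkhoffSum T f k x / a k) ∂m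
      - m.real (A ∩ T^[k] ⁻¹' B) * G (∫ x, f x ∂m)|) =o[atTop] a := by
  have hbound : (fun k => |∫ x in A ∩ T^[k] ⁻¹' B, G (birkhoffSum T f k x / a k) ∂m
      - m.real (A ∩ T^[k] ⁻¹' B) * G (∫ x, f x ∂m)|) =O[atTop] fun _ => (1 : ℝ) := by
    refine .of_bound (2 * ‖G‖ * m.real A) (.of_forall fun k => ?_)
    have hAt := hT.ring.measure_ne_top hA
    have hfin := measure_ne_top_of_subset (t := T^[k] ⁻¹' B ∩ A) Set.inter_subset_right hAt
    rw [Set.inter_comm, norm_abs_eq_norm, norm_one, mul_one]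
    calc _ ≤ ‖G‖ * m.real (T^[k] ⁻¹' B ∩ A) + m.real (T^[k] ⁻¹' B ∩ A) * ‖G‖ := by
          grw [norm_sub_le, norm_mul, G.norm_coe_le_norm, Real.norm_of_nonneg measureReal_nonneg,
            norm_setIntegral_le_of_norm_le_const hfin.lt_top fun x _ => G.norm_coe_le_norm _]
      _ ≤ 2 * ‖G‖ * m.real A := by
          grw [measureReal_mono Set.inter_subset_right hAt]
          linarith
  simpa only [sub_add_cancel] using
    (isLittleO_sum_Icc_sub_sum_range hbound (hT.tendsto_atTop hm)).add
    (hT.isLittleO_sum_range_setIntegral_sub hm hfi hf hf0 hlaw hA hB G)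

theorem isLittleO_sum_Icc_measureReal_sub (hT : IsWeaklyRationallyErgodic m T R a)
    (hm : ∃ s, m s ≠ 0 ∧ m s ≠ ⊤) (hA : A ∈ R) (hB : B ∈ R) :
    (fun n => ∑ k ∈ Finset.Icc 1 n, m.real (A ∩ T^[k] ⁻¹' B) - m.real A * m.real B * a n)
      =o[atTop] a := by
  have hbound : (fun k => m.real (A ∩ T^[k] ⁻¹' B)) =O[atTop] fun _ => (1 : ℝ) :=
    .of_bound (m.real A) (.of_forall fun k => by
      rw [Real.norm_of_nonneg measureReal_nonneg, norm_one, mul_one]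
      exact measureReal_mono Set.inter_subset_left (hT.ring.measure_ne_top hA))
  refine ((isLittleO_sum_Icc_sub_sum_range hbound (hT.tendsto_atTop hm)).add
    (hT.isLittleO_visitSum_sub hA hB)).congr_left fun n => ?_
  exact sub_add_sub_cancel _ _ _

end IsWeaklyRationallyErgodic

section MixingDiscrepancy

/-- The `n`-th error term `m(A ∩ T⁻ⁿ B) - m(A) m(B) u_n` in the definition of rational weak mixing
with weights `u`. -/
noncomputable def mixingDiscrepancy (m : Measure X) (T : X → X) (u : ℕ → ℝ) (A B : Set X)
    (n : ℕ) : ℝ :=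
  m.real (A ∩ T^[n] ⁻¹' B) - m.real A * m.real B * u n

theorem mixingDiscrepancy_eq_add_sdiff_left (hEA : E ⊆ A) (hE : MeasurableSet E) (hAt : m A ≠ ⊤)
    (n : ℕ) : mixingDiscrepancy m T u A B n
      = mixingDiscrepancy m T u E B n + mixingDiscrepancy m T u (A \ E) B n := by
  have hinter : m.real (A ∩ T^[n] ⁻¹' B)
      = m.real (E ∩ T^[n] ⁻¹' B) + m.real ((A \ E) ∩ T^[n] ⁻¹' B) := by
    rw [← measureReal_inter_add_sdiff (s := A ∩ T^[n] ⁻¹' B) hE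
      (measure_ne_top_of_subset Set.inter_subset_left hAt), Set.inter_right_comm,
      Set.inter_eq_right.2 hEA, Set.inter_sdiff_right_comm]
  simp only [mixingDiscrepancy, hinter, measureReal_sdiff hEA hE hAt]
  ring

theorem mixingDiscrepancy_eq_add_sdiff_right (hT : Measurable T) (hEB : E ⊆ B)
    (hE : MeasurableSet E) (hAt : m A ≠ ⊤) (hBt : m B ≠ ⊤) (n : ℕ) :
    mixingDiscrepancy m T u A B n
      = mixingDiscrepancy m T u A E n + mixingDiscrepancy m T u A (B \ E) n := by
  have hinter : m.real (A ∩ T^[n] ⁻¹' B)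
      = m.real (A ∩ T^[n] ⁻¹' E) + m.real (A ∩ T^[n] ⁻¹' (B \ E)) := by
    rw [← measureReal_inter_add_sdiff (s := A ∩ T^[n] ⁻¹' B) (hT.iterate n hE)
      (measure_ne_top_of_subset Set.inter_subset_left hAt), Set.inter_assoc, ← Set.preimage_inter,
      Set.inter_eq_right.2 hEB, Set.inter_sdiff_assoc, ← Set.preimage_sdiff]
  simp only [mixingDiscrepancy, hinter, measureReal_sdiff hEB hE hBt]
  ring

theorem sum_abs_mixingDiscrepancy_le_add_add (hT : Measurable T) (hEA : E ⊆ A)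
    (hE : MeasurableSet E) (hFB : F ⊆ B) (hF : MeasurableSet F) (hAt : m A ≠ ⊤) (hBt : m B ≠ ⊤)
    (I : Finset ℕ) :
    ∑ n ∈ I, |mixingDiscrepancy m T u A B n| ≤ ∑ n ∈ I, |mixingDiscrepancy m T u E F n|
      + ∑ n ∈ I, |mixingDiscrepancy m T u (A \ E) B n|
      + ∑ n ∈ I, |mixingDiscrepancy m T u E (B \ F) n| := by
  rw [← Finset.sum_add_distrib, ← Finset.sum_add_distrib]
  refine Finset.sum_le_sum fun n _ => ?_
  rw [mixingDiscrepancy_eq_add_sdiff_left hEA hE hAt, mixingDiscrepancy_eq_add_sdiff_right hT hFB hF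
    (measure_ne_top_of_subset hEA hAt) hBt, add_right_comm]
  exact abs_add_three _ _ _

end MixingDiscrepancy

namespace IsWeaklyRationallyErgodic

theorem exists_isLittleO_sum_abs_mixingDiscrepancy_self (hT : IsWeaklyRationallyErgodic m T R a)
    (hm : ∃ s, m s ≠ 0 ∧ m s ≠ ⊤) (hu : IsRationallyWeaklyMixing m T u) :
    ∃ A ∈ R, 0 < m.real A ∧ (fun N => ∑ n ∈ Finset.Icc 1 N, |mixingDiscrepancy m T u A A n|)
      =o[atTop] fun N => ∑ n ∈ Finset.Icc 1 N, u n := by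
  obtain ⟨-, R', hR', hmix⟩ := hu
  obtain ⟨A, ⟨hA, hA'⟩, hA0⟩ := hT.ring.exists_mem_inter_measureReal_pos hR' hm
  exact ⟨A, hA, hA0, hmix A hA' A hA'⟩

theorem isEquivalent_sum_weights (hT : IsWeaklyRationallyErgodic m T R a)
    (hm : ∃ s, m s ≠ 0 ∧ m s ≠ ⊤) (hu : IsRationallyWeaklyMixing m T u) :
    a ~[atTop] fun N => ∑ n ∈ Finset.Icc 1 N, u n := by
  obtain ⟨A, hA, hA0, hmix⟩ := hT.exists_isLittleO_sum_abs_mixingDiscrepancy_self hm hu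
  have hc : m.real A * m.real A ≠ 0 := by positivity
  have hVa : (fun N => ∑ n ∈ Finset.Icc 1 N, m.real (A ∩ T^[n] ⁻¹' A)) ~[atTop]
      fun N => m.real A * m.real A * a N :=
    (isLittleO_const_mul_right_iff hc).2 (hT.isLittleO_sum_Icc_measureReal_sub hm hA hA)
  have hVu : (fun N => ∑ n ∈ Finset.Icc 1 N, m.real (A ∩ T^[n] ⁻¹' A)) ~[atTop]
      fun N => m.real A * m.real A * ∑ n ∈ Finset.Icc 1 N, u n := by
    refine (isLittleO_const_mul_right_iff hc).2
      (IsBigO.trans_isLittleO (.of_norm_le fun N => ?_) hmix)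
    rw [Pi.sub_apply, Finset.mul_sum, ← Finset.sum_sub_distrib]
    exact Finset.abs_sum_le_sum_abs _ _
  have hau : (fun N => m.real A * m.real A * (a N - ∑ n ∈ Finset.Icc 1 N, u n)) =o[atTop]
      fun N => m.real A * m.real A * ∑ n ∈ Finset.Icc 1 N, u n :=
    (hVa.symm.trans hVu).isLittleO.congr_left fun N => (mul_sub _ _ _).symm
  exact (isLittleO_const_mul_left_iff hc).1 ((isLittleO_const_mul_right_iff hc).1 hau)

theorem isBigO_sum_abs_weights (hT : IsWeaklyRationallyErgodic m T R a)
    (hm : ∃ s, m s ≠ 0 ∧ m s ≠ ⊤) (hu : IsRationallyWeaklyMixing m T u) :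
    (fun N => ∑ n ∈ Finset.Icc 1 N, |u n|) =O[atTop] a := by
  obtain ⟨A, hA, hA0, hmix⟩ := hT.exists_isLittleO_sum_abs_mixingDiscrepancy_self hm hu
  have hΔ : (fun N => ∑ n ∈ Finset.Icc 1 N, |mixingDiscrepancy m T u A A n|) =O[atTop] a :=
    hmix.isBigO.trans (hT.isEquivalent_sum_weights hm hu).symm.isBigO
  have hc : 0 < m.real A * m.real A := mul_pos hA0 hA0
  have hV : (fun N => ∑ n ∈ Finset.Icc 1 N, m.real (A ∩ T^[n] ⁻¹' A)) =O[atTop] a := by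
    simpa only [sub_add_cancel] using (hT.isLittleO_sum_Icc_measureReal_sub hm hA hA).isBigO.add
      ((isBigO_refl a atTop).const_mul_left (m.real A * m.real A))
  refine (isBigO_const_mul_left_iff hc.ne').1
    (IsBigO.trans (.of_norm_le fun N => ?_) (hV.add hΔ))
  rw [Real.norm_of_nonneg (by positivity), Finset.mul_sum, ← Finset.sum_add_distrib]
  refine Finset.sum_le_sum fun n _ => ?_
  calc m.real A * m.real A * |u n| = |m.real A * m.real A * u n| := by
        rw [abs_mul, abs_of_pos hc]
    _ = |m.real (A ∩ T^[n] ⁻¹' A) - mixingDiscrepancy m T u A A n| := by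
        rw [mixingDiscrepancy, sub_sub_cancel]
    _ ≤ m.real (A ∩ T^[n] ⁻¹' A) + |mixingDiscrepancy m T u A A n| := by
        grw [abs_sub, abs_of_nonneg measureReal_nonneg]

theorem exists_isLittleO_sum_abs_mixingDiscrepancy_le (hT : IsWeaklyRationallyErgodic m T R a)
    (hm : ∃ s, m s ≠ 0 ∧ m s ≠ ⊤) (hA : A ∈ R) (hB : B ∈ R) (u : ℕ → ℝ) :
    ∃ e : ℕ → ℝ, e =o[atTop] a ∧ ∀ N, ∑ n ∈ Finset.Icc 1 N, |mixingDiscrepancy m T u A B n|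
      ≤ m.real A * m.real B * (a N + ∑ n ∈ Finset.Icc 1 N, |u n|) + e N := by
  refine ⟨_, hT.isLittleO_sum_Icc_measureReal_sub hm hA hB, fun N => ?_⟩
  calc ∑ n ∈ Finset.Icc 1 N, |mixingDiscrepancy m T u A B n|
      ≤ ∑ n ∈ Finset.Icc 1 N, (m.real (A ∩ T^[n] ⁻¹' B) + m.real A * m.real B * |u n|) := by
        refine Finset.sum_le_sum fun n _ => (abs_sub _ _).trans_eq ?_
        rw [abs_mul, abs_of_nonneg measureReal_nonneg, abs_of_nonneg (by positivity)]
    _ = _ := by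
        rw [Finset.sum_add_distrib, ← Finset.mul_sum]
        ring

-- Shrink `B` and `C` to members of the mixing ring `R'`: the removed pieces lie in `R`, where weak
-- rational ergodicity bounds their discrepancies by their measures.
theorem isLittleO_sum_abs_mixingDiscrepancy (hT : IsWeaklyRationallyErgodic m T R a)
    (hm : ∃ s, m s ≠ 0 ∧ m s ≠ ⊤) (hu : IsRationallyWeaklyMixing m T u) (hB : B ∈ R)
    (hC : C ∈ R) :
    (fun N => ∑ n ∈ Finset.Icc 1 N, |mixingDiscrepancy m T u B C n|) =o[atTop] a := by
  have hsum := hT.isBigO_sum_abs_weights hm hu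
  have hua := (hT.isEquivalent_sum_weights hm hu).symm.isBigO
  obtain ⟨-, R', hR', hmix⟩ := hu
  have hBt := hT.ring.measure_ne_top hB
  have hCt := hT.ring.measure_ne_top hC
  refine isLittleO_of_forall_norm_le_mul_add ((isBigO_refl a atTop).add hsum) fun w hw => ?_
  obtain ⟨η, hη, hηw⟩ : ∃ η > 0, (m.real B + m.real C) * η < w := exists_pos_mul_lt hw _
  obtain ⟨B', hB', hBB', hBη⟩ := hR'.exists_subset_sdiff_lt (hT.ring.measurableSet B hB) hBt hη
  obtain ⟨C', hC', hCC', hCη⟩ := hR'.exists_subset_sdiff_lt (hT.ring.measurableSet C hC) hCt hη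
  have hB'm := hR'.measurableSet B' hB'
  have hC'm := hR'.measurableSet C' hC'
  obtain ⟨e₁, he₁, hle₁⟩ :=
    hT.exists_isLittleO_sum_abs_mixingDiscrepancy_le hm (hT.ring.sdiff_mem hB hB'm) hC u
  obtain ⟨e₂, he₂, hle₂⟩ := hT.exists_isLittleO_sum_abs_mixingDiscrepancy_le hm
    (hT.ring.hereditary B hB B' hB'm hBB') (hT.ring.sdiff_mem hC hC'm) u
  have hmix' : (fun N => ∑ n ∈ Finset.Icc 1 N, |mixingDiscrepancy m T u B' C' n|) =o[atTop] a :=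
    (hmix B' hB' C' hC').trans_isBigO hua
  refine ⟨_, (hmix'.add he₁).add he₂, ?_⟩
  filter_upwards [eventually_ge_atTop 1] with N hN
  have hv : 0 ≤ a N + ∑ n ∈ Finset.Icc 1 N, |u n| :=
    add_nonneg (hT.pos N hN).le (Finset.sum_nonneg fun _ _ => abs_nonneg _)
  have hcoeff : m.real (B \ B') * m.real C + m.real B' * m.real (C \ C') ≤ w := by
    grw [hBη, hCη, measureReal_mono hBB' hBt]
    linarith
  rw [Real.norm_of_nonneg (Finset.sum_nonneg fun _ _ => abs_nonneg _), Real.norm_of_nonneg hv]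
  grw [sum_abs_mixingDiscrepancy_le_add_add hT.measurePreserving.measurable hBB' hB'm hCC' hC'm hBt
    hCt, hle₁ N, hle₂ N, ← hcoeff, ← Real.le_norm_self]
  linarith

theorem isLittleO_sum_abs_sub_weights (hT : IsWeaklyRationallyErgodic m T R a)
    (hm : ∃ s, m s ≠ 0 ∧ m s ≠ ⊤) (hu : IsRationallyWeaklyMixing m T u) (hB : B ∈ R) (hC : C ∈ R)
    {I : ℕ → ℝ} {y : ℝ}
    (hI : (fun N => ∑ n ∈ Finset.Icc 1 N, |I n - m.real (B ∩ T^[n] ⁻¹' C) * y|) =o[atTop] a) :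
    (fun N => ∑ n ∈ Finset.Icc 1 N, |I n - m.real B * m.real C * y * u n|) =o[atTop] a := by
  have hΔ := (hT.isLittleO_sum_abs_mixingDiscrepancy hm hu hB hC).const_mul_left |y|
  refine IsBigO.trans_isLittleO (.of_norm_le fun N => ?_) (hI.add hΔ)
  rw [Real.norm_of_nonneg (Finset.sum_nonneg fun _ _ => abs_nonneg _), Finset.mul_sum,
    ← Finset.sum_add_distrib]
  refine Finset.sum_le_sum fun n _ => ?_
  have hsplit : I n - m.real B * m.real C * y * u n
      = (I n - m.real (B ∩ T^[n] ⁻¹' C) * y) + y * mixingDiscrepancy m T u B C n := by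
    rw [mixingDiscrepancy]
    ring
  rw [hsplit, ← abs_mul]
  exact abs_add_le _ _

end IsWeaklyRationallyErgodic

theorem setIntegral_mul_indicator_comp {h : X → ℝ} {φ : X → X} (hB : MeasurableSet (φ ⁻¹' B)) :
    ∫ x in A, h x * B.indicator (fun _ => (1 : ℝ)) (φ x) ∂m = ∫ x in A ∩ φ ⁻¹' B, h x ∂m := by
  rw [← setIntegral_indicator hB]
  refine integral_congr_ae (.of_forall fun x => ?_)
  by_cases hx : φ x ∈ B <;> simp [hx]

end Systems

theorem proposition6_general {X : Type*} [MeasurableSpace X] (m : Measure X)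
    (hm : ∃ s, m s ≠ 0 ∧ m s ≠ ⊤) (T : X → X) (R : Set (Set X)) (a : ℕ → ℝ)
    (hT : IsWeaklyRationallyErgodic m T R a)
    (hconv : ∀ f : X → ℝ, Integrable f m →
      TendstoInMeasureOnFinite m (fun n x => birkhoffSum T f n x / a n) (fun _ => ∫ x, f x ∂m)) :
    (∀ f : X → ℝ, Integrable f m → 0 ≤ᵐ[m] f → ∀ g : ℝ≥0 →ᵇ ℝ, ∀ A ∈ R, ∀ B ∈ R,
      Tendsto (fun n : ℕ => (1 / a n) * ∑ k ∈ Finset.Icc 1 n,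
        |(∫ x in A, g (birkhoffSum T f k x / a k).toNNReal *
              B.indicator (fun _ => (1 : ℝ)) (T^[k] x) ∂m)
            - g (∫ x, f x ∂m).toNNReal * m.real (A ∩ T^[k] ⁻¹' B)|)
        atTop (𝓝 0)) ∧
    (∀ u : ℕ → ℝ, IsRationallyWeaklyMixing m T u →
      a ~[atTop] (fun N : ℕ => ∑ n ∈ Finset.Icc 1 N, u n) ∧
      ∀ f : X → ℝ, Integrable f m → 0 ≤ᵐ[m] f → ∀ g : ℝ≥0 →ᵇ ℝ, ∀ B ∈ R, ∀ C ∈ R,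
        Tendsto (fun N : ℕ => (1 / a N) * ∑ n ∈ Finset.Icc 1 N,
          |(∫ x in B ∩ T^[n] ⁻¹' C, g (birkhoffSum T f n x / a n).toNNReal ∂m)
            - m.real B * m.real C * g (∫ x, f x ∂m).toNNReal * u n|)
          atTop (𝓝 0)) := by
  have hpart1 : ∀ f : X → ℝ, Integrable f m → 0 ≤ᵐ[m] f → ∀ g : ℝ≥0 →ᵇ ℝ, ∀ A ∈ R, ∀ B ∈ R,
      (fun n => ∑ k ∈ Finset.Icc 1 n,
        |∫ x in A ∩ T^[k] ⁻¹' B, g (birkhoffSum T f k x / a k).toNNReal ∂m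
          - m.real (A ∩ T^[k] ⁻¹' B) * g (∫ x, f x ∂m).toNNReal|) =o[atTop] a :=
    fun f hf hf0 g A hA B hB => hT.isLittleO_sum_Icc_setIntegral_sub hm hf (hconv f hf) hf0
      (hconv _ (hT.ring.integrable_indicator_one hB)) hA hB
      (g.compContinuous ⟨Real.toNNReal, continuous_real_toNNReal⟩)
  refine ⟨fun f hf hf0 g A hA B hB => ?_, fun u hu =>
    ⟨hT.isEquivalent_sum_weights hm hu, fun f hf hf0 g B hB C hC => ?_⟩⟩
  · have hpre : ∀ k, MeasurableSet (T^[k] ⁻¹' B) := fun k =>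
      hT.measurePreserving.measurable.iterate k (hT.ring.measurableSet B hB)
    simp_rw [one_div_mul_eq_div, setIntegral_mul_indicator_comp (hpre _), mul_comm (g _)]
    exact (hpart1 f hf hf0 g A hA B hB).tendsto_div_nhds_zero
  · simp_rw [one_div_mul_eq_div]
    exact (hT.isLittleO_sum_abs_sub_weights hm hu hB hC
      (hpart1 f hf hf0 g B hB C hC)).tendsto_div_nhds_zero

theorem proposition6 {X : Type*} [TopologicalSpace X] [PolishSpace X] [MeasurableSpace X]
    [BorelSpace X] (m : Measure X) [SigmaFinite m] [NullSingletonClass m] (hm : m ≠ 0)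
    (T : X → X) (R : Set (Set X)) (a : ℕ → ℝ)
    (hT : IsWeaklyRationallyErgodic m T R a)
    (hconv : ∀ f : X → ℝ, Integrable f m →
      TendstoInMeasureOnFinite m (fun n x => birkhoffSum T f n x / a n) (fun _ => ∫ x, f x ∂m)) :
    (∀ f : X → ℝ, Integrable f m → 0 ≤ᵐ[m] f → ∀ g : ℝ≥0 →ᵇ ℝ, ∀ A ∈ R, ∀ B ∈ R,
      Tendsto (fun n : ℕ => (1 / a n) * ∑ k ∈ Finset.Icc 1 n,
        |(∫ x in A, g (birkhoffSum T f k x / a k).toNNReal *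
              B.indicator (fun _ => (1 : ℝ)) (T^[k] x) ∂m)
            - g (∫ x, f x ∂m).toNNReal * m.real (A ∩ T^[k] ⁻¹' B)|)
        atTop (𝓝 0)) ∧
    (∀ u : ℕ → ℝ, IsRationallyWeaklyMixing m T u →
      a ~[atTop] (fun N : ℕ => ∑ n ∈ Finset.Icc 1 N, u n) ∧
      ∀ f : X → ℝ, Integrable f m → 0 ≤ᵐ[m] f → ∀ g : ℝ≥0 →ᵇ ℝ, ∀ B ∈ R, ∀ C ∈ R,
        Tendsto (fun N : ℕ => (1 / a N) * ∑ n ∈ Finset.Icc 1 N,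
          |(∫ x in B ∩ T^[n] ⁻¹' C, g (birkhoffSum T f n x / a n).toNNReal ∂m)
            - m.real B * m.real C * g (∫ x, f x ∂m).toNNReal * u n|)
          atTop (𝓝 0)) := by
  exact proposition6_general m (exists_measure_ne_zero_ne_top m hm) T R a hT hconv
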